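/- Setting. Let $K\ge 1$ clients share model information in $\mathbb R^n$. Let $\mu_0,g\in\mathbb R^n$ and let $\Sigma_0=\mathrm{diag}(v_1,\dots,v_n)$, $\Sigma'=\mathrm{diag}(v'_1,\dots,v'_n)$ with all $v_i,v'_i>0$. The unprotected information of each client has law $P^{\mathcal O}=\mathcal N(\mu_0,\Sigma_0)$. In the sparsity mechanism each client uploads the first $d$ of the $n$ dimensions ($0\le d\le n$): write $\mu_0=(\mu_u,\mu_o)$, $\Sigma_0=\mathrm{diag}(\Sigma_u,\Sigma_o)$ with blocks of size $d$ and $n-d$, let $\mu_g$ and $\Sigma_g$ be the last $n-d$ coordinates of $g$ and the corresponding block of $\Sigma'$, and let the protected information have law $P^{\mathcal S}=\mathcal N((\mu_u,\mu_g),\mathrm{diag}(\Sigma_u,\Sigma_g))$. The aggregated laws $P_a^{\mathcal O}$, $P_a^{\mathcal S}$ are the laws of $\frac1K\sum_{k=1}^K W_k$ for independent $W_k\sim P^{\mathcal O}$, respectively $W_k\sim P^{\mathcal S}$ (so the covariances are divided by $K$). The private data set $D_k$ of client $k$ (a finite nonempty data set) takes values in $\mathcal D_k$. With respect to a reference measure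 on $\mathcal D_k$, the adversary has a positive prior density $f_{D_k}$ and positive posterior densities $f_{D_k|W_k}(\cdot|w)$, $w\in\mathbb R^n$. Let $F^{\mathcal B}_k$, $F^{\mathcal O}_k$, $F^{\mathcal A}_k$ be the distributions with densities $f_{D_k}$, $\int f_{D_k|W_k}(\cdot|w)\,dP^{\mathcal O}(w)$ and $\int f_{D_k|W_k}(\cdot|w)\,dP^{\mathcal S}(w)$. Put $$\epsilon_p=\frac1K\sum_{k}\sqrt{\mathrm{JS}(F_k^{\mathcal A}\|F_k^{\mathcal B})},\qquad C_1=\frac1K\sum_{k}\sqrt{\mathrm{JS}(F_k^{\mathcal O}\|F_k^{\mathcal B})},\qquad C_3=\frac{\sqrt2\,(e^{2\xi}-1)}2,$$ where $\mathrm{JS}$ is the Jensen–Shannon divergence and $\xi=\max_k\sup_{w\in\mathbb R^n,\,D\in\mathcal D_k}\bigl|\log\frac{f_{D_k|W_k}(D|w)}{f_{D_k}(D)}\bigr|$ is assumed finite. Let $U(w,z)$ be a measurable utility function with $U(w,z)\ge 0$ and $\sqrt2\,U(w,z)\le C$ for all $w\in\mathbb R^n$ and all data points $z$ of data sets in $\mathcal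 D_k$, for every $k$, and let $$\epsilon_u=\frac1K\sum_k\bigl[U_k(P^{\mathcal O}_a)-U_k(P^{\mathcal S}_a)\bigr],\qquad U_k(P)=\mathbb E_{D_k}\mathbb E_{W\sim P}\frac1{|D_k|}\sum_{z\in D_k}U(W,z),$$ where $D_k$ is sampled from a given probability distribution $P_k$ concentrated on $\mathcal D_k$. Finally let $$h(\mu_1,\Sigma_1,\mu_2,\Sigma_2)=\Bigl(1-\tfrac{\det(\Sigma_1)^{1/4}\det(\Sigma_2)^{1/4}}{\det(\frac{\Sigma_1+\Sigma_2}2)^{1/2}}\exp\bigl\{-\tfrac18(\mu_1-\mu_2)^T(\tfrac{\Sigma_1+\Sigma_2}2)^{-1}(\mu_1-\mu_2)\bigr\}\Bigr)^{1/2},$$ $h(d)=h(\mu_o,\Sigma_o,\mu_g,\Sigma_g)$ and $h_K(d)=h(\mu_o,\Sigma_o/K,\mu_g,\Sigma_g/K)$ for $0\le d\le n$. Proposition. (1) $h(d)$ is a decreasing (non-increasing) function of the number $d$ of uploaded dimensions, and $h(d+1)<h(d)$ whenever $d<n$ and the $(d+1)$-st coordinates of $\mathcal N(\mu_0,\Sigma_0)$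 and $\mathcal N(g,\Sigma')$ differ in mean or variance. (2) For every $d$, $\epsilon_p\ge C_1-C_3\,h(d)$, and this lower bound is an increasing (non-decreasing) function of $d$. (3) For every $d$, $\epsilon_u\le C\,h_K(d)$ and $\epsilon_u\le\sqrt K\,C\,h(d)$ (for $K=1$ both read $\epsilon_u\le C\,h(d)$), and $C\,h(d)$, $C\,h_K(d)$ and $\sqrt K\,C\,h(d)$ are decreasing (non-increasing) functions of $d$. -/

import Mathlib

open MeasureTheory ProbabilityTheory
open scoped Matrix

namespace FederatedSparsity

noncomputable section

/-- The Hellinger-type quantity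
`h(μ₁, Σ₁, μ₂, Σ₂) = (1 - det(Σ₁)^{1/4} det(Σ₂)^{1/4} / det((Σ₁+Σ₂)/2)^{1/2}
  * exp(-(1/8) (μ₁-μ₂)ᵀ ((Σ₁+Σ₂)/2)⁻¹ (μ₁-μ₂)))^{1/2}`. -/
def hGauss {ι : Type*} [Fintype ι] [DecidableEq ι]
    (μ₁ : ι → ℝ) (S₁ : Matrix ι ι ℝ) (μ₂ : ι → ℝ) (S₂ : Matrix ι ι ℝ) : ℝ :=
  Real.sqrt (1 - S₁.det ^ (1 / 4 : ℝ) * S₂.det ^ (1 / 4 : ℝ)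
      / ((1 / 2 : ℝ) • (S₁ + S₂)).det ^ (1 / 2 : ℝ)
    * Real.exp (-(1 / 8) * ((μ₁ - μ₂) ⬝ᵥ (((1 / 2 : ℝ) • (S₁ + S₂))⁻¹ *ᵥ (μ₁ - μ₂)))))

/-- The space of model information. -/
abbrev Param (n : ℕ) := EuclideanSpace ℝ (Fin n)

/-- The Gaussian data of the sparsity mechanism: mean and (diagonal) variances of the original
model information, and mean and variances of the Gaussian vector which replaces the coordinates
that are not uploaded.  When `d` coordinates are uploaded only the coordinates `d, …, n-1` of the
latter are used. -/
structure Mechanism (n : ℕ) where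
  origMean : Param n
  origVar : Fin n → ℝ
  guessMean : Param n
  guessVar : Fin n → ℝ
  origVar_pos : ∀ i, 0 < origVar i
  guessVar_pos : ∀ i, 0 < guessVar i

namespace Mechanism

variable {n : ℕ} (M : Mechanism n)

/-- `P^O = N(μ₀, Σ₀)`. -/
def origLaw : Measure (Param n) :=
  multivariateGaussian M.origMean (Matrix.diagonal M.origVar)

/-- `μ = (μ_u, μ_g)`: the first `d` coordinates are those of the original mean. -/
def protMean (d : ℕ) : Param n :=
  WithLp.toLp 2 (fun i : Fin n => if (i : ℕ) < d then M.origMean i else M.guessMean i)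

/-- The diagonal of `Σ = diag(Σ_u, Σ_g)`. -/
def protVar (d : ℕ) (i : Fin n) : ℝ :=
  if (i : ℕ) < d then M.origVar i else M.guessVar i

/-- `P^S = N(μ, Σ)` when `d` coordinates are uploaded. -/
def protLaw (d : ℕ) : Measure (Param n) :=
  multivariateGaussian (M.protMean d) (Matrix.diagonal (M.protVar d))

/-- The quantity `h(μ_o, μ_g, c Σ_o, c Σ_g)`, formed from the last `n - d` coordinates, with both
covariance matrices multiplied by a scalar `c`. -/
def hTail (c : ℝ) (d : ℕ) : ℝ :=
  hGauss (ι := {i : Fin n // d ≤ (i : ℕ)})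
    (fun i => M.origMean i.1) (c • Matrix.diagonal (fun i => M.origVar i.1))
    (fun i => M.guessMean i.1) (c • Matrix.diagonal (fun i => M.guessVar i.1))

/-- `h(μ_o, μ_g, Σ_o, Σ_g)` as a function of the number `d` of uploaded dimensions. -/
def h (d : ℕ) : ℝ := M.hTail 1 d

/-- `h(μ_o, μ_g, Σ_o / K, Σ_g / K)` as a function of the number `d` of uploaded dimensions. -/
def hAgg (K d : ℕ) : ℝ := M.hTail (1 / (K : ℝ)) d

end Mechanism

/-- The law of the server's aggregate `(1/K) ∑ₖ Wₖ` for independent `Wₖ`, each with law `P`. -/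
def aggregateLaw {n : ℕ} (K : ℕ) (P : Measure (Param n)) : Measure (Param n) :=
  (Measure.pi (fun _ : Fin K => P)).map (fun w => (1 / (K : ℝ)) • ∑ k, w k)

/-- Finite nonempty data sets with data points in `Z`, listed as tuples. -/
abbrev Dataset (Z : Type*) := Σ m : ℕ, (Fin (m + 1) → Z)

/-- A client `k` together with the beliefs of the adversary about the client's private data `D_k`.
`support` is the set `𝒟_k`, `ref` the measure with respect to which densities on `𝒟_k` are taken,
`prior` is `f_{D_k}`, `posterior D w` is `f_{D_k|W_k}(D|w)`, and `dataLaw` is the distribution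
`P_k` from which the client's data set is sampled. -/
structure Client (Z : Type*) [MeasurableSpace Z] (n : ℕ) where
  support : Set (Dataset Z)
  measurableSet_support : MeasurableSet support
  ref : Measure (Dataset Z)
  prior : Dataset Z → ℝ
  measurable_prior : Measurable prior
  prior_pos : ∀ D ∈ support, 0 < prior D
  integral_prior : ∫ D in support, prior D ∂ref = 1
  posterior : Dataset Z → Param n → ℝ
  measurable_posterior : Measurable (Function.uncurry posterior)
  posterior_pos : ∀ D ∈ support, ∀ w, 0 < posterior D w
  integral_posterior : ∀ w, ∫ D in support, posterior D w ∂ref = 1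
  dataLaw : Measure (Dataset Z)
  isProbabilityMeasure_dataLaw : IsProbabilityMeasure dataLaw
  dataLaw_compl_support : dataLaw supportᶜ = 0

/-- The Jensen-Shannon divergence of the distributions on `s` with densities `f` and `g` with
respect to `ν`. -/
def jsDiv {α : Type*} [MeasurableSpace α] (ν : Measure α) (s : Set α) (f g : α → ℝ) : ℝ :=
  (1 / 2) * ∫ x in s, f x * Real.log (f x / ((f x + g x) / 2)) ∂ν
    + (1 / 2) * ∫ x in s, g x * Real.log (g x / ((f x + g x) / 2)) ∂ν

namespace Client

variable {Z : Type*} [MeasurableSpace Z] {n : ℕ} (c : Client Z n)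

/-- The density of the adversary's belief about `D_k` after observing model information with
law `P`: `f(D) = ∫ f_{D_k|W_k}(D|w) dP(w)`. -/
def belief (P : Measure (Param n)) (D : Dataset Z) : ℝ := ∫ w, c.posterior D w ∂P

/-- The square root of the Jensen-Shannon divergence between the belief after observing model
information with law `P` and the prior belief. -/
def leakage (P : Measure (Param n)) : ℝ :=
  Real.sqrt (jsDiv c.ref c.support (c.belief P) c.prior)

/-- All values `|log (f_{D_k|W_k}(D|w) / f_{D_k}(D))|` for `D ∈ 𝒟_k` and `w ∈ 𝒲_k`. Here `𝒲_k`, the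
union of the supports of two nondegenerate Gaussian laws, is the whole space. -/
def logRatios : Set ℝ :=
  {r | ∃ D ∈ c.support, ∃ w : Param n, r = |Real.log (c.posterior D w / c.prior D)|}

/-- The expected utility `U_k(P) = E_{D_k ∼ P_k} E_{W ∼ P} (1/|D_k|) ∑_{z ∈ D_k} U(W, z)`. -/
def expectedUtility (U : Param n → Z → ℝ) (P : Measure (Param n)) : ℝ :=
  ∫ D : Dataset Z, ∫ w, (1 / ((D.1 : ℝ) + 1)) * ∑ i, U w (D.2 i) ∂P ∂c.dataLaw

end Client

section System

variable {Z : Type*} [MeasurableSpace Z] {n K : ℕ}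

/-- `ξ = max_k ξ_k`, with `ξ_k` the largest absolute log-ratio of posterior and prior. -/
def xi (clients : Fin K → Client Z n) : ℝ := ⨆ k, sSup (clients k).logRatios

/-- `(1/K) ∑ₖ √JS(F_k ‖ F^B_k)`, with `F_k` the belief after observing model information of law
`P`. -/
def avgLeakage (clients : Fin K → Client Z n) (P : Measure (Param n)) : ℝ :=
  (1 / (K : ℝ)) * ∑ k, (clients k).leakage P

/-- `C₁ = (1/K) ∑ₖ √JS(F^O_k ‖ F^B_k)`. -/
def constC₁ (clients : Fin K → Client Z n) (M : Mechanism n) : ℝ :=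
  avgLeakage clients M.origLaw

/-- `C₃ = √2 (e^{2ξ} - 1) / 2`. -/
def constC₃ (clients : Fin K → Client Z n) : ℝ :=
  Real.sqrt 2 * (Real.exp (2 * xi clients) - 1) / 2

/-- The Bayesian privacy leakage `ε_p` when each client uploads `d` dimensions. -/
def privacyLeakage (clients : Fin K → Client Z n) (M : Mechanism n) (d : ℕ) : ℝ :=
  avgLeakage clients (M.protLaw d)

/-- The utility loss `ε_u` when each client uploads `d` dimensions. -/
def utilityLoss (clients : Fin K → Client Z n) (M : Mechanism n) (U : Param n → Z → ℝ)
    (d : ℕ) : ℝ :=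
  (1 / (K : ℝ)) * ∑ k, ((clients k).expectedUtility U (aggregateLaw K M.origLaw)
    - (clients k).expectedUtility U (aggregateLaw K (M.protLaw d)))

end System

end

end FederatedSparsity

/-! Everything reduces to Hellinger affinities (integrals of `√(pq)`) of Gaussians. With diagonal
covariances the affinity of two laws is the product over coordinates of one-dimensional affinities
in `(0, 1]`. An uploaded coordinate has the same law on both sides and contributes 1, so `h(d)² = 1
- ∏_{i ≥ d} aᵢ`. Raising `d` only deletes factors, which gives all the monotonicity claims; a factor
is below 1 exactly when mean or variance differ (`gaussAffinity_lt_one` for the direction needed).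

Both inequalities rest on one estimate (`abs_integral_mul_sub_le_hellinger`): expectations of a
function of oscillation at most `B` differ by at most `B √2 h`. For the utility, `B = C/√2` and the
aggregated laws are Gaussians with variances divided by `K`. The passage from `h_K` to `√K h` uses
`a^K ≤ a_K` for the affinities together with Bernoulli's inequality (`hAgg_le`).

For privacy, the estimate is applied to the posterior as a function of `w`, which lies between
`e^{-ξ}` and `e^{ξ}` times the prior. Since the Jensen-Shannon integrand is at most `(p-q)²/(p+q)`,
this gives `√JS(F^O‖F^A) ≤ C₃ h`. The triangle inequality for `√JS` then finishes. It is proved by a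
Hilbert space embedding: the integrand equals half of `∫₀^∞ (∫_p^q e^{-ts} ds)² dt`, so its square
root is an `L²` norm of a function additive in the interval `[p, q]`, and Minkowski's inequality
applies, first in `t` and then over the data space. -/

namespace FederatedSparsity

/-! ### Cauchy-Schwarz and Minkowski for square-integrable functions. -/

section L2

variable {α : Type*} [MeasurableSpace α] {μ : Measure α}

lemma integrable_mul_of_sq {f g : α → ℝ} (hf : AEStronglyMeasurable f μ)
    (hg : AEStronglyMeasurable g μ) (hf2 : Integrable (fun x => f x ^ 2) μ)
    (hg2 : Integrable (fun x => g x ^ 2) μ) : Integrable (fun x => f x * g x) μ := by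
  refine Integrable.mono' (hf2.add hg2) (hf.mul hg) (ae_of_all _ fun x => ?_)
  simp only [Real.norm_eq_abs, Pi.add_apply, abs_mul]
  nlinarith [sq_nonneg (|f x| - |g x|), sq_abs (f x), sq_abs (g x), sq_nonneg (f x),
    sq_nonneg (g x)]

/-- General `t` feeds the discriminant proof of Cauchy-Schwarz; `t = 1` gives Minkowski, and `t =
±1` give the norms of `√q ± √p` in the Hellinger bound. -/
lemma integral_mul_add_sq {f g : α → ℝ} (hf : AEStronglyMeasurable f μ)
    (hg : AEStronglyMeasurable g μ) (hf2 : Integrable (fun x => f x ^ 2) μ)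
    (hg2 : Integrable (fun x => g x ^ 2) μ) (t : ℝ) :
    Integrable (fun x => (t * f x + g x) ^ 2) μ ∧ ∫ x, (t * f x + g x) ^ 2 ∂μ
      = t ^ 2 * ∫ x, f x ^ 2 ∂μ + 2 * t * ∫ x, f x * g x ∂μ + ∫ x, g x ^ 2 ∂μ := by
  have hfg := integrable_mul_of_sq hf hg hf2 hg2
  have hexp : (fun x => (t * f x + g x) ^ 2)
      = fun x => (t ^ 2 * f x ^ 2 + (2 * t) * (f x * g x)) + g x ^ 2 := by
    funext x
    ring
  have h1 : Integrable (fun x => t ^ 2 * f x ^ 2 + (2 * t) * (f x * g x)) μ :=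
    (hf2.const_mul _).add (hfg.const_mul _)
  rw [hexp]
  refine ⟨h1.add hg2, ?_⟩
  rw [integral_add h1 hg2, integral_add (hf2.const_mul _) (hfg.const_mul _),
    integral_const_mul, integral_const_mul]

lemma sq_integral_mul_le {f g : α → ℝ} (hf : AEStronglyMeasurable f μ)
    (hg : AEStronglyMeasurable g μ) (hf2 : Integrable (fun x => f x ^ 2) μ)
    (hg2 : Integrable (fun x => g x ^ 2) μ) :
    (∫ x, f x * g x ∂μ) ^ 2 ≤ (∫ x, f x ^ 2 ∂μ) * ∫ x, g x ^ 2 ∂μ := by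
  have key : ∀ t : ℝ, 0 ≤ (∫ x, f x ^ 2 ∂μ) * (t * t) + (2 * ∫ x, f x * g x ∂μ) * t
      + ∫ x, g x ^ 2 ∂μ := by
    intro t
    have h0 : 0 ≤ ∫ x, (t * f x + g x) ^ 2 ∂μ := integral_nonneg fun x => sq_nonneg _
    rw [(integral_mul_add_sq hf hg hf2 hg2 t).2] at h0
    linarith
  have := discrim_le_zero key
  rw [discrim] at this
  linarith

lemma integral_mul_le_sqrt {f g : α → ℝ} (hf : AEStronglyMeasurable f μ)
    (hg : AEStronglyMeasurable g μ) (hf2 : Integrable (fun x => f x ^ 2) μ)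
    (hg2 : Integrable (fun x => g x ^ 2) μ) :
    ∫ x, f x * g x ∂μ ≤ √(∫ x, f x ^ 2 ∂μ) * √(∫ x, g x ^ 2 ∂μ) := by
  rw [← Real.sqrt_mul (integral_nonneg fun x => sq_nonneg _)]
  exact Real.le_sqrt_of_sq_le (sq_integral_mul_le hf hg hf2 hg2)

/-- Minkowski's inequality in `L²`. -/
lemma sqrt_integral_sq_le_add {f g h : α → ℝ} (hg : AEStronglyMeasurable g μ)
    (hh : AEStronglyMeasurable h μ) (hg2 : Integrable (fun x => g x ^ 2) μ)
    (hh2 : Integrable (fun x => h x ^ 2) μ) (hle : ∀ᵐ x ∂μ, f x ^ 2 ≤ (g x + h x) ^ 2) :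
    √(∫ x, f x ^ 2 ∂μ) ≤ √(∫ x, g x ^ 2 ∂μ) + √(∫ x, h x ^ 2 ∂μ) := by
  obtain ⟨hint, heq⟩ := integral_mul_add_sq hg hh hg2 hh2 1
  simp only [one_mul] at hint heq
  have h1 : ∫ x, f x ^ 2 ∂μ ≤ ∫ x, (g x + h x) ^ 2 ∂μ :=
    integral_mono_of_nonneg (ae_of_all _ fun x => sq_nonneg _) hint hle
  rw [heq] at h1
  have h2 := integral_mul_le_sqrt hg hh hg2 hh2
  apply Real.sqrt_le_iff.2 ⟨by positivity, ?_⟩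
  have e1 := Real.sq_sqrt (integral_nonneg (μ := μ) fun x => sq_nonneg (g x))
  have e2 := Real.sq_sqrt (integral_nonneg (μ := μ) fun x => sq_nonneg (h x))
  nlinarith

end L2

/-! ### The Jensen-Shannon integrand and its embedding in `L²(0, ∞)`. -/

section Kernel

/-- The integrand of (twice) the Jensen-Shannon divergence. -/
noncomputable def jsKernel (p q : ℝ) : ℝ :=
  p * Real.log (p / ((p + q) / 2)) + q * Real.log (q / ((p + q) / 2))

lemma jsKernel_comm (p q : ℝ) : jsKernel p q = jsKernel q p := by
  unfold jsKernel
  rw [add_comm q p, add_comm]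

lemma mul_log_div_mid_le {p q : ℝ} (hp : 0 < p) (hq : 0 < q) :
    p * Real.log (p / ((p + q) / 2)) ≤ p * (p - q) / (p + q) := by
  have h := Real.log_le_sub_one_of_pos (x := p / ((p + q) / 2)) (by positivity)
  calc _ ≤ p * (p / ((p + q) / 2) - 1) := by gcongr
    _ = _ := by field_simp; ring

/-- This is `log y ≤ y - 1` at the reciprocal of the ratio; the ratio itself gives the companion
upper bound. The lower bounds for `(p, q)` and `(q, p)` cancel, whence the kernel is nonnegative. -/
lemma le_mul_log_div_mid {p q : ℝ} (hp : 0 < p) (hq : 0 < q) :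
    (p - q) / 2 ≤ p * Real.log (p / ((p + q) / 2)) := by
  have h := Real.log_le_sub_one_of_pos (x := (p / ((p + q) / 2))⁻¹) (by positivity)
  rw [Real.log_inv] at h
  have h' : 1 - (p / ((p + q) / 2))⁻¹ ≤ Real.log (p / ((p + q) / 2)) := by linarith
  calc _ = p * (1 - (p / ((p + q) / 2))⁻¹) := by field_simp; ring
    _ ≤ _ := by gcongr

lemma jsKernel_nonneg {p q : ℝ} (hp : 0 < p) (hq : 0 < q) : 0 ≤ jsKernel p q := by
  have h1 := le_mul_log_div_mid hp hq
  have h2 := le_mul_log_div_mid hq hp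
  rw [add_comm q p] at h2
  unfold jsKernel
  linarith

lemma jsKernel_le {p q : ℝ} (hp : 0 < p) (hq : 0 < q) :
    jsKernel p q ≤ (p - q) ^ 2 / (p + q) := by
  have h1 := mul_log_div_mid_le hp hq
  have h2 := mul_log_div_mid_le hq hp
  rw [add_comm q p] at h2
  have : (p - q) ^ 2 / (p + q) = p * (p - q) / (p + q) + q * (q - p) / (p + q) := by
    field_simp; ring
  unfold jsKernel
  linarith

/-- `∫ₚ^q e^{-ts} ds`. -/
noncomputable def expFeature (p q t : ℝ) : ℝ := ∫ s in p..q, Real.exp (-(t * s))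

lemma continuous_expFeature (p q : ℝ) : Continuous (expFeature p q) := by
  unfold expFeature
  apply intervalIntegral.continuous_parametric_intervalIntegral_of_continuous'
  fun_prop

/-- This additivity is what turns the triangle inequality for `√jsKernel` into Minkowski's
inequality. -/
lemma expFeature_add (p r q t : ℝ) :
    expFeature p r t + expFeature r q t = expFeature p q t := by
  unfold expFeature
  apply intervalIntegral.integral_add_adjacent_intervals <;>
  exact Continuous.intervalIntegrable (by fun_prop) _ _

lemma expFeature_symm (p q t : ℝ) : expFeature q p t = - expFeature p q t :=
  intervalIntegral.integral_symm _ _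

lemma integral_exp_neg_mul_Ioi {a : ℝ} (ha : 0 < a) :
    ∫ t in Set.Ioi (0 : ℝ), Real.exp (-(t * a)) = 1 / a := by
  have := integral_exp_mul_Ioi (a := -a) (by linarith) 0
  simp only [mul_zero, Real.exp_zero] at this
  rw [← neg_div_neg_eq, ← this]
  congr 1 with t
  ring_nf

lemma integrableOn_exp_neg_mul_Ioi {a : ℝ} (ha : 0 < a) :
    IntegrableOn (fun t => Real.exp (-(t * a))) (Set.Ioi (0 : ℝ)) := by
  have := integrableOn_exp_mul_Ioi (a := -a) (by linarith) 0
  refine this.congr_fun (fun t _ => ?_) measurableSet_Ioi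
  simp only
  ring_nf

/-- Two explicit integrations, using that `x log x - x` is a primitive of `log`. The value at the
mixed argument `p + q` produces the midpoint in `jsKernel`. -/
lemma integral_integral_inv_add {p q : ℝ} (hp : 0 < p) (hpq : p ≤ q) :
    ∫ s in p..q, ∫ u in p..q, 1 / (s + u) = 2 * jsKernel p q := by
  have hq : 0 < q := hp.trans_le hpq
  have h1 : ∀ s ∈ Set.uIcc p q, ∫ u in p..q, 1 / (s + u)
      = Real.log (s + q) - Real.log (s + p) := by
    intro s hs
    rw [Set.uIcc_of_le hpq] at hs
    have hs0 : 0 < s := hp.trans_le hs.1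
    rw [intervalIntegral.integral_comp_add_left (fun x => 1 / x), integral_one_div_of_pos
      (by positivity) (by positivity), Real.log_div (by positivity) (by positivity)]
  have hi : ∀ a, 0 < a → IntervalIntegrable (fun s => Real.log (s + a)) volume p q := by
    intro a ha
    apply ContinuousOn.intervalIntegrable
    rw [Set.uIcc_of_le hpq]
    apply ContinuousOn.log (by fun_prop)
    intro x hx
    linarith [hx.1]
  rw [intervalIntegral.integral_congr h1, intervalIntegral.integral_sub (hi q hq) (hi p hp),
    intervalIntegral.integral_comp_add_right (fun x => Real.log x),
    intervalIntegral.integral_comp_add_right (fun x => Real.log x), integral_log, integral_log]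
  unfold jsKernel
  rw [Real.log_div hp.ne' (by positivity), Real.log_div hq.ne' (by positivity),
    Real.log_div (by positivity) (by norm_num), ← two_mul, ← two_mul,
    Real.log_mul (by norm_num) hp.ne', Real.log_mul (by norm_num) hq.ne', add_comm q p]
  ring

lemma expFeature_sq {p q : ℝ} (hpq : p ≤ q) (t : ℝ) : expFeature p q t ^ 2
    = ∫ z, Real.exp (-(t * (z.1 + z.2)))
      ∂((volume.restrict (Set.Ioc p q)).prod (volume.restrict (Set.Ioc p q))) := by
  rw [sq]
  unfold expFeature
  rw [intervalIntegral.integral_of_le hpq, ← integral_prod_mul]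
  congr 1 with z
  rw [← Real.exp_add]
  ring_nf

/-- Fubini: the square is a double integral of `e^{-t(s+u)}` over `(p, q]²`, and integrating in `t`
first leaves `1/(s+u)`. -/
lemma expFeature_sq_integral_of_le {p q : ℝ} (hp : 0 < p) (hpq : p ≤ q) :
    IntegrableOn (fun t => expFeature p q t ^ 2) (Set.Ioi 0) ∧
      ∫ t in Set.Ioi 0, expFeature p q t ^ 2 = 2 * jsKernel p q := by
  set ρ := (volume.restrict (Set.Ioc p q)).prod (volume.restrict (Set.Ioc p q)) with hρ
  have hmem : ∀ᵐ z ∂ρ, z ∈ Set.Ioc p q ×ˢ Set.Ioc p q := by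
    rw [hρ, Measure.prod_restrict]
    exact ae_restrict_mem (measurableSet_Ioc.prod measurableSet_Ioc)
  have hint : Integrable (fun y : ℝ × (ℝ × ℝ) => Real.exp (-(y.1 * (y.2.1 + y.2.2))))
      ((volume.restrict (Set.Ioi 0)).prod ρ) := by
    -- Both integration variables exceed `p`, so `e^{-2pt}` dominates; here `p > 0` is essential.
    have hdom : Integrable (fun y : ℝ × (ℝ × ℝ) => Real.exp (-(y.1 * (2 * p))) * 1)
        ((volume.restrict (Set.Ioi 0)).prod ρ) :=
      Integrable.mul_prod (integrableOn_exp_neg_mul_Ioi (a := 2 * p) (by positivity))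
        (integrable_const _)
    refine hdom.mono' (by fun_prop) ?_
    have h1 : ∀ᵐ y ∂((volume.restrict (Set.Ioi (0 : ℝ))).prod ρ), y.1 ∈ Set.Ioi (0 : ℝ) :=
      Measure.quasiMeasurePreserving_fst.ae (ae_restrict_mem measurableSet_Ioi)
    have h2 : ∀ᵐ y ∂((volume.restrict (Set.Ioi (0 : ℝ))).prod ρ),
        y.2 ∈ Set.Ioc p q ×ˢ Set.Ioc p q :=
      Measure.quasiMeasurePreserving_snd.ae hmem
    filter_upwards [h1, h2] with y hy1 hy2
    rw [Real.norm_eq_abs, Real.abs_exp, mul_one]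
    have hy0 : 0 < y.1 := hy1
    have := hy2.1.1
    have := hy2.2.1
    gcongr
    linarith
  have hswap := integral_integral_swap
    (f := fun (t : ℝ) (z : ℝ × ℝ) => Real.exp (-(t * (z.1 + z.2)))) hint
  have hleft := hint.integral_prod_left
  simp only [← expFeature_sq hpq, hρ] at hleft hswap
  refine ⟨hleft, ?_⟩
  rw [hswap, ← integral_integral_inv_add hp hpq]
  have hinner : ∀ᵐ z ∂ρ, ∫ t in Set.Ioi 0, Real.exp (-(t * (z.1 + z.2))) = 1 / (z.1 + z.2) := by
    filter_upwards [hmem] with z hz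
    have := hz.1.1
    have := hz.2.1
    exact integral_exp_neg_mul_Ioi (by linarith)
  have hright := hint.integral_prod_right.congr hinner
  rw [integral_congr_ae hinner, integral_prod _ hright, intervalIntegral.integral_of_le hpq]
  congr 1 with s
  rw [intervalIntegral.integral_of_le hpq]

lemma expFeature_sq_integral {p q : ℝ} (hp : 0 < p) (hq : 0 < q) :
    IntegrableOn (fun t => expFeature p q t ^ 2) (Set.Ioi 0) ∧
      ∫ t in Set.Ioi 0, expFeature p q t ^ 2 = 2 * jsKernel p q := by
  rcases le_total p q with h | h
  · exact expFeature_sq_integral_of_le hp h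
  · have := expFeature_sq_integral_of_le hq h
    rw [jsKernel_comm]
    simpa only [expFeature_symm q p, neg_sq, even_two.neg_pow] using this

/-- The square root of the Jensen-Shannon kernel is a metric on the positive reals. -/
lemma sqrt_jsKernel_triangle {p r q : ℝ} (hp : 0 < p) (hr : 0 < r) (hq : 0 < q) :
    √(jsKernel p q) ≤ √(jsKernel p r) + √(jsKernel r q) := by
  obtain ⟨-, e1⟩ := expFeature_sq_integral hp hq
  obtain ⟨i2, e2⟩ := expFeature_sq_integral hp hr
  obtain ⟨i3, e3⟩ := expFeature_sq_integral hr hq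
  have h := sqrt_integral_sq_le_add (f := expFeature p q)
    (continuous_expFeature p r).aestronglyMeasurable
    (continuous_expFeature r q).aestronglyMeasurable i2 i3
    (ae_of_all _ fun t => by rw [expFeature_add])
  rw [e1, e2, e3, Real.sqrt_mul (by norm_num), Real.sqrt_mul (by norm_num),
    Real.sqrt_mul (by norm_num), ← mul_add] at h
  exact le_of_mul_le_mul_left h (by positivity)

end Kernel

/-! ### The triangle inequality for `√JS`. -/

section JensenShannon

variable {α : Type*} [MeasurableSpace α] {ν : Measure α} {s : Set α}

/-- The elementary bounds on the logarithm trap the integrand between `(f - g)/2` and `f`, so `f +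
g` dominates its absolute value. -/
lemma integrableOn_mul_log_div_mid {f g : α → ℝ} (hs : MeasurableSet s) (hfm : Measurable f)
    (hgm : Measurable g) (hf : IntegrableOn f s ν) (hg : IntegrableOn g s ν)
    (hf0 : ∀ x ∈ s, 0 < f x) (hg0 : ∀ x ∈ s, 0 < g x) :
    IntegrableOn (fun x => f x * Real.log (f x / ((f x + g x) / 2))) s ν := by
  refine Integrable.mono' (hf.add hg) (by fun_prop) ?_
  filter_upwards [ae_restrict_mem hs] with x hx
  have hp := hf0 x hx
  have hq := hg0 x hx
  have h1 := le_mul_log_div_mid hp hq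
  have h2 := mul_log_div_mid_le hp hq
  have h3 : f x * (f x - g x) / (f x + g x) ≤ f x := by
    rw [div_le_iff₀ (by positivity)]
    nlinarith [mul_pos hp hq]
  rw [Real.norm_eq_abs, abs_le, Pi.add_apply]
  constructor <;> linarith

lemma integrableOn_jsKernel {f g : α → ℝ} (hs : MeasurableSet s) (hfm : Measurable f)
    (hgm : Measurable g) (hf : IntegrableOn f s ν) (hg : IntegrableOn g s ν)
    (hf0 : ∀ x ∈ s, 0 < f x) (hg0 : ∀ x ∈ s, 0 < g x) :
    IntegrableOn (fun x => jsKernel (f x) (g x)) s ν ∧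
      jsDiv ν s f g = 1 / 2 * ∫ x in s, jsKernel (f x) (g x) ∂ν := by
  have h1 := integrableOn_mul_log_div_mid hs hfm hgm hf hg hf0 hg0
  have h2 := integrableOn_mul_log_div_mid hs hgm hfm hg hf hg0 hf0
  simp only [add_comm (g _) (f _)] at h2
  refine ⟨h1.add h2, ?_⟩
  unfold jsDiv jsKernel
  rw [integral_add h1 h2]
  ring

/-- The triangle inequality for the square root of the Jensen-Shannon divergence. -/
lemma sqrt_jsDiv_triangle {f g h : α → ℝ} (hs : MeasurableSet s) (hfm : Measurable f)
    (hgm : Measurable g) (hhm : Measurable h) (hf : IntegrableOn f s ν) (hg : IntegrableOn g s ν)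
    (hh : IntegrableOn h s ν) (hf0 : ∀ x ∈ s, 0 < f x) (hg0 : ∀ x ∈ s, 0 < g x)
    (hh0 : ∀ x ∈ s, 0 < h x) :
    √(jsDiv ν s f h) ≤ √(jsDiv ν s f g) + √(jsDiv ν s g h) := by
  have hsq : ∀ {u v : α → ℝ}, (∀ x ∈ s, 0 < u x) → (∀ x ∈ s, 0 < v x) →
      (fun x => √(jsKernel (u x) (v x)) ^ 2) =ᵐ[ν.restrict s] fun x => jsKernel (u x) (v x) := by
    intro u v hu hv
    filter_upwards [ae_restrict_mem hs] with x hx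
    exact Real.sq_sqrt (jsKernel_nonneg (hu x hx) (hv x hx))
  obtain ⟨-, e1⟩ := integrableOn_jsKernel hs hfm hhm hf hh hf0 hh0
  obtain ⟨i2, e2⟩ := integrableOn_jsKernel hs hfm hgm hf hg hf0 hg0
  obtain ⟨i3, e3⟩ := integrableOn_jsKernel hs hgm hhm hg hh hg0 hh0
  have hmeas : ∀ {u v : α → ℝ}, Measurable u → Measurable v →
      AEStronglyMeasurable (fun x => √(jsKernel (u x) (v x))) (ν.restrict s) := by
    intro u v hu hv
    unfold jsKernel
    fun_prop
  -- The pointwise triangle inequality on the positive reals is integrated by a second use of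
  -- Minkowski, now over the data space.
  have key := sqrt_integral_sq_le_add (f := fun x => √(jsKernel (f x) (h x))) (hmeas hfm hgm)
    (hmeas hgm hhm) (i2.congr (hsq hf0 hg0).symm) (i3.congr (hsq hg0 hh0).symm) (by
      filter_upwards [ae_restrict_mem hs] with x hx
      have := sqrt_jsKernel_triangle (hf0 x hx) (hg0 x hx) (hh0 x hx)
      gcongr)
  rw [integral_congr_ae (hsq hf0 hh0), integral_congr_ae (hsq hf0 hg0),
    integral_congr_ae (hsq hg0 hh0)] at key
  rw [e1, e2, e3, Real.sqrt_mul (by norm_num), Real.sqrt_mul (by norm_num),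
    Real.sqrt_mul (by norm_num), ← mul_add]
  gcongr

end JensenShannon

/-! ### Expectations of bounded functions and the Hellinger affinity. -/

section Hellinger

variable {α : Type*} [MeasurableSpace α] {μ : Measure α}

/-- Centre `g` at the midpoint of its range, factor `|p - q| = |√p - √q| (√p + √q)`, and apply
Cauchy-Schwarz. With affinity `β`, the two squared norms are `2 - 2β` and `2 + 2β ≤ 4`. -/
lemma abs_integral_mul_sub_le_hellinger {p q : α → ℝ} (hp : Measurable p) (hq : Measurable q)
    (hp0 : ∀ x, 0 ≤ p x) (hq0 : ∀ x, 0 ≤ q x) (hpi : Integrable p μ) (hqi : Integrable q μ)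
    (hp1 : ∫ x, p x ∂μ = 1) (hq1 : ∫ x, q x ∂μ = 1) {g : α → ℝ} (hg : Measurable g) {a B : ℝ}
    (hg1 : ∀ x, a ≤ g x) (hg2 : ∀ x, g x ≤ a + B) :
    |∫ x, p x * g x ∂μ - ∫ x, q x * g x ∂μ|
      ≤ B * (√2 * √(1 - ∫ x, √(p x * q x) ∂μ)) := by
  have hB : 0 ≤ B := by
    have : Nonempty α := by
      by_contra h
      rw [not_nonempty_iff] at h
      simp [integral_of_isEmpty] at hp1
    obtain ⟨x⟩ := this
    linarith [hg1 x, hg2 x]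
  have hbd : ∀ x, ‖g x‖ ≤ |a| + B := fun x => by
    rw [Real.norm_eq_abs, abs_le]
    constructor <;> linarith [hg1 x, hg2 x, neg_abs_le a, le_abs_self a]
  have hpg : Integrable (fun x => p x * g x) μ :=
    hpi.mul_bdd hg.aestronglyMeasurable (ae_of_all _ hbd)
  have hqg : Integrable (fun x => q x * g x) μ :=
    hqi.mul_bdd hg.aestronglyMeasurable (ae_of_all _ hbd)
  have hsp : ∀ x, √(p x) ^ 2 = p x := fun x => Real.sq_sqrt (hp0 x)
  have hsq : ∀ x, √(q x) ^ 2 = q x := fun x => Real.sq_sqrt (hq0 x)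
  have hmul : ∀ x, √(p x) * √(q x) = √(p x * q x) := fun x => (Real.sqrt_mul (hp0 x) _).symm
  have hpm : AEStronglyMeasurable (fun x => √(p x)) μ := hp.sqrt.aestronglyMeasurable
  have hqm : AEStronglyMeasurable (fun x => √(q x)) μ := hq.sqrt.aestronglyMeasurable
  have hp2 : Integrable (fun x => √(p x) ^ 2) μ := by simpa only [hsp] using hpi
  have hq2 : Integrable (fun x => √(q x) ^ 2) μ := by simpa only [hsq] using hqi
  obtain ⟨i1, e1⟩ := integral_mul_add_sq hpm hqm hp2 hq2 1
  obtain ⟨i2, e2⟩ := integral_mul_add_sq hpm hqm hp2 hq2 (-1)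
  simp only [hsp, hsq, hmul, hp1, hq1] at e1 e2
  set β := ∫ x, √(p x * q x) ∂μ with hβ
  have hβ1 : β ≤ 1 := by
    have : 0 ≤ ∫ x, (-1 * √(p x) + √(q x)) ^ 2 ∂μ := integral_nonneg fun x => sq_nonneg _
    linarith
  have hm1 : AEStronglyMeasurable (fun x => |1 * √(p x) + √(q x)|) μ := by fun_prop
  have hm2 : AEStronglyMeasurable (fun x => |-1 * √(p x) + √(q x)|) μ := by fun_prop
  have hcs := integral_mul_le_sqrt hm1 hm2 (by simpa only [sq_abs] using i1)
    (by simpa only [sq_abs] using i2)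
  simp only [sq_abs, e1, e2] at hcs
  have habs : ∀ x, |1 * √(p x) + √(q x)| * |-1 * √(p x) + √(q x)| = |p x - q x| := fun x => by
    rw [← abs_mul, ← abs_neg]
    congr 1
    linear_combination hsp x - hsq x
  simp only [habs] at hcs
  -- Since `p` and `q` have equal mass, a constant may be subtracted from `g`; the midpoint makes
  -- the sup norm `B/2` rather than `B`.
  have hdiff : ∫ x, p x * g x ∂μ - ∫ x, q x * g x ∂μ
      = ∫ x, (p x - q x) * (g x - (a + B / 2)) ∂μ := by
    have : (fun x => (p x - q x) * (g x - (a + B / 2)))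
        = fun x => (p x * g x - q x * g x) - (a + B / 2) * (p x - q x) := by
      funext x
      ring
    have hsub : Integrable (fun x => p x - q x) μ := hpi.sub hqi
    have hsubg : Integrable (fun x => p x * g x - q x * g x) μ := hpg.sub hqg
    rw [this, integral_sub hsubg (hsub.const_mul _), integral_sub hpg hqg,
      integral_const_mul, integral_sub hpi hqi, hp1, hq1]
    ring
  have hle : |∫ x, (p x - q x) * (g x - (a + B / 2)) ∂μ| ≤ ∫ x, (B / 2) * |p x - q x| ∂μ := by
    rw [← Real.norm_eq_abs]
    refine norm_integral_le_of_norm_le ((hpi.sub hqi).abs.const_mul _) (ae_of_all _ fun x => ?_)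
    rw [Real.norm_eq_abs, abs_mul, mul_comm]
    gcongr
    rw [abs_le]
    constructor <;> linarith [hg1 x, hg2 x]
  rw [integral_const_mul] at hle
  have hs1 : √(1 ^ 2 * 1 + 2 * 1 * β + 1) ≤ 2 := by
    rw [Real.sqrt_le_left (by norm_num)]
    linarith
  have hs2 : √((-1) ^ 2 * 1 + 2 * -1 * β + 1) = √2 * √(1 - β) := by
    rw [← Real.sqrt_mul (by norm_num)]
    congr 1
    ring
  rw [hs2] at hcs
  rw [hdiff]
  calc _ ≤ B / 2 * ∫ x, |p x - q x| ∂μ := hle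
    _ ≤ B / 2 * (2 * (√2 * √(1 - β))) := by
      gcongr
      exact hcs.trans (by gcongr)
    _ = _ := by ring

end Hellinger

/-! ### The affinity of one-dimensional Gaussians. -/

section Gaussian

/-- The Hellinger affinity of two Gaussian laws on the real line. -/
noncomputable def gaussAffinity (m₁ v₁ m₂ v₂ : ℝ) : ℝ :=
  v₁ ^ (1 / 4 : ℝ) * v₂ ^ (1 / 4 : ℝ) / ((1 / 2) * (v₁ + v₂)) ^ (1 / 2 : ℝ)
    * Real.exp (-(1 / 8) * ((m₁ - m₂) ^ 2 / ((1 / 2) * (v₁ + v₂))))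

/-- Fourth powers clear all fractional exponents, so comparisons with 1 become `4 v₁ v₂ ≤ (v₁ +
v₂)²`, strict for `v₁ ≠ v₂`. -/
lemma varianceFactor_pow_four {v₁ v₂ : ℝ} (h₁ : 0 < v₁) (h₂ : 0 < v₂) :
    (v₁ ^ (1 / 4 : ℝ) * v₂ ^ (1 / 4 : ℝ) / ((1 / 2) * (v₁ + v₂)) ^ (1 / 2 : ℝ)) ^ 4
      = 4 * v₁ * v₂ / (v₁ + v₂) ^ 2 := by
  have e : ∀ v : ℝ, 0 < v → (v ^ (1 / 4 : ℝ)) ^ 4 = v := fun v hv => by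
    rw [← Real.rpow_natCast, ← Real.rpow_mul hv.le]
    norm_num
  have e' : ∀ v : ℝ, 0 < v → (v ^ (1 / 2 : ℝ)) ^ 4 = v ^ 2 := fun v hv => by
    rw [← Real.rpow_natCast, ← Real.rpow_mul hv.le, ← Real.rpow_natCast]
    norm_num
  rw [div_pow, mul_pow, e _ h₁, e _ h₂, e' _ (by positivity)]
  field_simp
  norm_num

lemma varianceFactor_le_one {v₁ v₂ : ℝ} (h₁ : 0 < v₁) (h₂ : 0 < v₂) :
    v₁ ^ (1 / 4 : ℝ) * v₂ ^ (1 / 4 : ℝ) / ((1 / 2) * (v₁ + v₂)) ^ (1 / 2 : ℝ) ≤ 1 := by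
  rw [← pow_le_one_iff_of_nonneg (by positivity) (four_ne_zero), varianceFactor_pow_four h₁ h₂,
    div_le_one (by positivity)]
  nlinarith [sq_nonneg (v₁ - v₂)]

lemma varianceFactor_lt_one {v₁ v₂ : ℝ} (h₁ : 0 < v₁) (h₂ : 0 < v₂) (h : v₁ ≠ v₂) :
    v₁ ^ (1 / 4 : ℝ) * v₂ ^ (1 / 4 : ℝ) / ((1 / 2) * (v₁ + v₂)) ^ (1 / 2 : ℝ) < 1 := by
  rw [← pow_lt_one_iff_of_nonneg (by positivity) (four_ne_zero), varianceFactor_pow_four h₁ h₂,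
    div_lt_one (by positivity)]
  have := sq_pos_of_pos (abs_pos.2 (sub_ne_zero.2 h))
  rw [sq_abs] at this
  nlinarith

lemma gaussAffinity_pos (m₁ m₂ : ℝ) {v₁ v₂ : ℝ} (h₁ : 0 < v₁) (h₂ : 0 < v₂) :
    0 < gaussAffinity m₁ v₁ m₂ v₂ := by
  unfold gaussAffinity
  positivity

lemma gaussAffinity_le_one (m₁ m₂ : ℝ) {v₁ v₂ : ℝ} (h₁ : 0 < v₁) (h₂ : 0 < v₂) :
    gaussAffinity m₁ v₁ m₂ v₂ ≤ 1 := by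
  have h : Real.exp (-(1 / 8) * ((m₁ - m₂) ^ 2 / ((1 / 2) * (v₁ + v₂)))) ≤ 1 := by
    rw [Real.exp_le_one_iff, neg_mul, neg_nonpos]
    positivity
  exact mul_le_one₀ (varianceFactor_le_one h₁ h₂) (Real.exp_nonneg _) h

lemma gaussAffinity_lt_one {m₁ m₂ v₁ v₂ : ℝ} (h₁ : 0 < v₁) (h₂ : 0 < v₂)
    (h : m₁ ≠ m₂ ∨ v₁ ≠ v₂) : gaussAffinity m₁ v₁ m₂ v₂ < 1 := by
  have hle : Real.exp (-(1 / 8) * ((m₁ - m₂) ^ 2 / ((1 / 2) * (v₁ + v₂)))) ≤ 1 := by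
    rw [Real.exp_le_one_iff, neg_mul, neg_nonpos]
    positivity
  rcases h with h | h
  · have hlt : Real.exp (-(1 / 8) * ((m₁ - m₂) ^ 2 / ((1 / 2) * (v₁ + v₂)))) < 1 := by
      have := sub_ne_zero.2 h
      rw [Real.exp_lt_one_iff, neg_mul, neg_lt_zero]
      positivity
    exact mul_lt_one_of_nonneg_of_lt_one_right (varianceFactor_le_one h₁ h₂)
      (Real.exp_nonneg _) hlt
  · exact mul_lt_one_of_nonneg_of_lt_one_left (by positivity) (varianceFactor_lt_one h₁ h₂ h) hle

lemma gaussAffinity_self (m : ℝ) {v : ℝ} (hv : 0 < v) : gaussAffinity m v m v = 1 := by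
  unfold gaussAffinity
  rw [← Real.rpow_add hv, show 1 / 2 * (v + v) = v by ring, ← Real.rpow_sub hv]
  norm_num

/-- Completing the square: the integrand is a constant times a Gaussian centred at the
precision-weighted mean `m`, and the remainder `E` is the exponent of the affinity. The prefactors
are matched after taking fourth powers. -/
lemma integral_sqrt_gaussianPDF_mul (m₁ m₂ : ℝ) {v₁ v₂ : ℝ} (h₁ : 0 < v₁) (h₂ : 0 < v₂) :
    ∫ x, √(gaussianPDFReal m₁ v₁.toNNReal x * gaussianPDFReal m₂ v₂.toNNReal x)
      = gaussAffinity m₁ v₁ m₂ v₂ := by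
  set A : ℝ := √((√(2 * Real.pi * v₁))⁻¹ * (√(2 * Real.pi * v₂))⁻¹) with hA
  set b : ℝ := (v₁ + v₂) / (4 * v₁ * v₂) with hb
  set m : ℝ := (m₁ * v₂ + m₂ * v₁) / (v₁ + v₂) with hm
  set E : ℝ := -(1 / 8) * ((m₁ - m₂) ^ 2 / ((1 / 2) * (v₁ + v₂))) with hE
  have hpt : ∀ x, √(gaussianPDFReal m₁ v₁.toNNReal x * gaussianPDFReal m₂ v₂.toNNReal x)
      = A * Real.exp E * Real.exp (-b * (x - m) ^ 2) := by
    intro x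
    rw [gaussianPDFReal_def, gaussianPDFReal_def]
    simp only [Real.coe_toNNReal _ h₁.le, Real.coe_toNNReal _ h₂.le]
    rw [mul_mul_mul_comm, ← Real.exp_add, Real.sqrt_mul (by positivity), ← hA, mul_assoc,
      ← Real.exp_add]
    congr 1
    rw [← Real.exp_half]
    congr 1
    rw [hE, hb, hm]
    field_simp
    ring
  simp only [hpt]
  rw [integral_const_mul, integral_sub_right_eq_self (fun x => Real.exp (-b * x ^ 2)),
    integral_gaussian]
  unfold gaussAffinity
  rw [mul_right_comm]
  congr 1
  have hbpos : 0 < b := by positivity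
  refine (pow_left_inj₀ (by positivity) (by positivity) (four_ne_zero)).1 ?_
  rw [varianceFactor_pow_four h₁ h₂, mul_pow, hA]
  have e : ∀ x : ℝ, 0 ≤ x → √x ^ 4 = x ^ 2 := fun x hx => by
    rw [show 4 = 2 * 2 from rfl, pow_mul, Real.sq_sqrt hx]
  rw [e _ (by positivity), e _ (by positivity), mul_pow, inv_pow, inv_pow,
    Real.sq_sqrt (by positivity), Real.sq_sqrt (by positivity), hb]
  field_simp
  ring

end Gaussian

/-! ### Gaussians with diagonal covariance as product measures. -/

section Multivariate

variable {ι : Type*} [Fintype ι]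

lemma pi_withDensity_ofReal {p : ι → ℝ → ℝ} (hp0 : ∀ i x, 0 ≤ p i x)
    (hpi : ∀ i, Integrable (p i)) :
    Measure.pi (fun i => volume.withDensity fun x => ENNReal.ofReal (p i x))
      = (volume : Measure (ι → ℝ)).withDensity fun x => ENNReal.ofReal (∏ i, p i (x i)) := by
  have hfin : ∀ i, IsFiniteMeasure (volume.withDensity fun x => ENNReal.ofReal (p i x)) :=
    fun i => isFiniteMeasure_withDensity_ofReal (hpi i).2
  refine Measure.pi_eq fun s hs => ?_
  rw [withDensity_apply _ (MeasurableSet.univ_pi hs), volume_pi, Measure.restrict_pi_pi,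
    ← ofReal_integral_eq_lintegral_ofReal
      (Integrable.fintype_prod_dep fun i => (hpi i).integrableOn)
      (ae_of_all _ fun x => Finset.prod_nonneg fun i _ => hp0 i _),
    integral_fintype_prod_eq_prod,
    ENNReal.ofReal_prod_of_nonneg fun i _ => integral_nonneg fun x => hp0 i x]
  refine Finset.prod_congr rfl fun i _ => ?_
  rw [withDensity_apply _ (hs i), ofReal_integral_eq_lintegral_ofReal (hpi i).integrableOn
    (ae_of_all _ (hp0 i))]

variable [DecidableEq ι]

lemma multivariateGaussian_diagonal (m : EuclideanSpace ℝ ι) {v : ι → ℝ} (hv : ∀ i, 0 ≤ v i) :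
    multivariateGaussian m (Matrix.diagonal v)
      = (Measure.pi fun i => gaussianReal (m i) (v i).toNNReal).map (WithLp.toLp 2) := by
  have : IsProbabilityMeasure
      ((Measure.pi fun i => gaussianReal (m i) (v i).toNNReal).map (WithLp.toLp 2)) :=
    Measure.isProbabilityMeasure_map (by fun_prop)
  apply Measure.ext_of_charFun (E := EuclideanSpace ℝ ι)
  ext t
  rw [charFun_multivariateGaussian (Matrix.PosSemidef.diagonal hv), charFun_pi]
  simp_rw [charFun_gaussianReal, ← Complex.exp_sum]
  congr 1
  simp [Matrix.mulVec_diagonal, dotProduct, PiLp.inner_apply, Finset.sum_sub_distrib,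
    Finset.sum_div, Finset.sum_mul]
  congr 1 <;> refine Finset.sum_congr rfl fun i _ => ?_
  · ring
  · rw [max_eq_left (hv i)]
    ring

/-- The difference of the expectations of a bounded function under two Gaussian laws with
diagonal covariance matrices. -/
lemma abs_integral_gaussian_sub_le {m₁ m₂ : EuclideanSpace ℝ ι} {v₁ v₂ : ι → ℝ}
    (h₁ : ∀ i, 0 < v₁ i) (h₂ : ∀ i, 0 < v₂ i) {g : EuclideanSpace ℝ ι → ℝ} (hg : Measurable g)
    {a B : ℝ} (hg1 : ∀ x, a ≤ g x) (hg2 : ∀ x, g x ≤ a + B) :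
    |∫ x, g x ∂multivariateGaussian m₁ (Matrix.diagonal v₁)
        - ∫ x, g x ∂multivariateGaussian m₂ (Matrix.diagonal v₂)|
      ≤ B * (√2 * √(1 - ∏ i, gaussAffinity (m₁ i) (v₁ i) (m₂ i) (v₂ i))) := by
  have hmeas : ∀ (m : EuclideanSpace ℝ ι) (v : ι → ℝ),
      Measurable fun x : ι → ℝ => ∏ i, gaussianPDFReal (m i) (v i).toNNReal (x i) := fun m v =>
    Finset.measurable_prod _ fun i _ => (measurable_gaussianPDFReal _ _).comp
      (measurable_pi_apply i)
  have hrep : ∀ (m : EuclideanSpace ℝ ι) (v : ι → ℝ), (∀ i, 0 < v i) →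
      ∫ x, g x ∂multivariateGaussian m (Matrix.diagonal v)
        = ∫ x : ι → ℝ, (∏ i, gaussianPDFReal (m i) (v i).toNNReal (x i)) * g (WithLp.toLp 2 x) := by
    intro m v hv
    have hv' : ∀ i, (v i).toNNReal ≠ 0 := fun i => by simpa using hv i
    rw [multivariateGaussian_diagonal m fun i => (hv i).le,
      integral_map (by fun_prop) hg.aestronglyMeasurable]
    simp_rw [gaussianReal_of_var_ne_zero _ (hv' _), gaussianPDF_def]
    rw [pi_withDensity_ofReal (fun i => gaussianPDFReal_nonneg _ _)
      (fun i => integrable_gaussianPDFReal _ _),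
      integral_withDensity_eq_integral_toReal_smul (hmeas m v).ennreal_ofReal
        (ae_of_all _ fun x => ENNReal.ofReal_lt_top)]
    congr 1 with x
    rw [ENNReal.toReal_ofReal (Finset.prod_nonneg fun i _ => gaussianPDFReal_nonneg _ _ _),
      smul_eq_mul]
  have hone : ∀ (m : EuclideanSpace ℝ ι) (v : ι → ℝ), (∀ i, 0 < v i) →
      ∫ x : ι → ℝ, ∏ i, gaussianPDFReal (m i) (v i).toNNReal (x i) = 1 := by
    intro m v hv
    rw [integral_fintype_prod_volume_eq_prod]
    refine Finset.prod_eq_one fun i _ => integral_gaussianPDFReal_eq_one _ ?_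
    simpa using hv i
  have hnn : ∀ (m : EuclideanSpace ℝ ι) (v x : ι → ℝ),
      0 ≤ ∏ i, gaussianPDFReal (m i) (v i).toNNReal (x i) := fun m v x =>
    Finset.prod_nonneg fun i _ => gaussianPDFReal_nonneg _ _ _
  -- The square root of a product density splits over coordinates, so by Fubini the affinity is
  -- multiplicative.
  have haff : ∫ x : ι → ℝ, √((∏ i, gaussianPDFReal (m₁ i) (v₁ i).toNNReal (x i))
        * ∏ i, gaussianPDFReal (m₂ i) (v₂ i).toNNReal (x i))
      = ∏ i, gaussAffinity (m₁ i) (v₁ i) (m₂ i) (v₂ i) := by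
    simp_rw [← integral_sqrt_gaussianPDF_mul _ _ (h₁ _) (h₂ _)]
    rw [← integral_fintype_prod_volume_eq_prod]
    congr 1 with x
    rw [← Finset.prod_mul_distrib, Real.sqrt_eq_rpow, ← Real.finsetProd_rpow _ _ fun i _ =>
      mul_nonneg (gaussianPDFReal_nonneg _ _ _) (gaussianPDFReal_nonneg _ _ _)]
    simp_rw [Real.sqrt_eq_rpow]
  rw [hrep _ _ h₁, hrep _ _ h₂, ← haff]
  exact abs_integral_mul_sub_le_hellinger (hmeas _ _) (hmeas _ _) (hnn _ _) (hnn _ _)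
    (Integrable.fintype_prod_dep fun i => integrable_gaussianPDFReal _ _)
    (Integrable.fintype_prod_dep fun i => integrable_gaussianPDFReal _ _)
    (hone _ _ h₁) (hone _ _ h₂) (hg.comp (by fun_prop)) (fun x => hg1 _) (fun x => hg2 _)

end Multivariate

/-! ### The matrix formula for `h` in terms of affinities, and rescaled variances. -/

section Affinity

variable {ι : Type*} [Fintype ι] [DecidableEq ι]

lemma hGauss_diagonal {m₁ m₂ v₁ v₂ : ι → ℝ} (h₁ : ∀ i, 0 < v₁ i) (h₂ : ∀ i, 0 < v₂ i) :
    hGauss m₁ (Matrix.diagonal v₁) m₂ (Matrix.diagonal v₂)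
      = √(1 - ∏ i, gaussAffinity (m₁ i) (v₁ i) (m₂ i) (v₂ i)) := by
  have hmid : (1 / 2 : ℝ) • (Matrix.diagonal v₁ + Matrix.diagonal v₂)
      = Matrix.diagonal fun i => (1 / 2) * (v₁ i + v₂ i) := by
    rw [Matrix.diagonal_add, ← Matrix.diagonal_smul]
    rfl
  have hpos : ∀ i, 0 < (1 / 2) * (v₁ i + v₂ i) := fun i => by
    have := h₁ i
    have := h₂ i
    positivity
  have hinv : (Matrix.diagonal fun i => (1 / 2) * (v₁ i + v₂ i))⁻¹
      = Matrix.diagonal fun i => ((1 / 2) * (v₁ i + v₂ i))⁻¹ := by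
    apply Matrix.inv_eq_right_inv
    rw [Matrix.diagonal_mul_diagonal, ← Matrix.diagonal_one]
    congr 1 with i
    exact mul_inv_cancel₀ (hpos i).ne'
  unfold hGauss gaussAffinity
  rw [hmid, hinv, Matrix.det_diagonal, Matrix.det_diagonal, Matrix.det_diagonal,
    ← Real.finsetProd_rpow _ _ fun i _ => (h₁ i).le,
    ← Real.finsetProd_rpow _ _ fun i _ => (h₂ i).le,
    ← Real.finsetProd_rpow _ _ fun i _ => (hpos i).le, Finset.prod_mul_distrib,
    Finset.prod_div_distrib, Finset.prod_mul_distrib, ← Real.exp_sum, ← Finset.mul_sum]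
  congr 4
  simp only [dotProduct, Matrix.mulVec_diagonal, Pi.sub_apply]
  congr 1
  refine Finset.sum_congr rfl fun i _ => ?_
  rw [div_eq_mul_inv]
  ring

/-- Dividing variances by `K` leaves the variance factor unchanged and multiplies the exponent by
`K`. The `K`-th power does the same to the exponent but also raises the variance factor, which is at
most 1. -/
lemma pow_gaussAffinity_le (m₁ m₂ : ℝ) {v₁ v₂ : ℝ} (h₁ : 0 < v₁) (h₂ : 0 < v₂) {K : ℕ}
    (hK : 0 < K) : gaussAffinity m₁ v₁ m₂ v₂ ^ K
      ≤ gaussAffinity m₁ (1 / K * v₁) m₂ (1 / K * v₂) := by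
  have hK' : (0 : ℝ) < K := by exact_mod_cast hK
  have hscale : (1 / K * v₁) ^ (1 / 4 : ℝ) * (1 / K * v₂) ^ (1 / 4 : ℝ)
        / ((1 / 2) * (1 / K * v₁ + 1 / K * v₂)) ^ (1 / 2 : ℝ)
      = v₁ ^ (1 / 4 : ℝ) * v₂ ^ (1 / 4 : ℝ) / ((1 / 2) * (v₁ + v₂)) ^ (1 / 2 : ℝ) := by
    refine (pow_left_inj₀ (by positivity) (by positivity) four_ne_zero).1 ?_
    rw [varianceFactor_pow_four h₁ h₂, varianceFactor_pow_four (by positivity) (by positivity)]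
    field_simp
  unfold gaussAffinity
  rw [hscale, mul_pow, ← Real.exp_nat_mul]
  have hexp : (K : ℝ) * (-(1 / 8) * ((m₁ - m₂) ^ 2 / ((1 / 2) * (v₁ + v₂))))
      = -(1 / 8) * ((m₁ - m₂) ^ 2 / ((1 / 2) * (1 / K * v₁ + 1 / K * v₂))) := by
    field_simp
  rw [hexp]
  gcongr
  exact pow_le_of_le_one (by positivity) (varianceFactor_le_one h₁ h₂) hK.ne'

end Affinity

/-! ### Dependence of `h` on the number of uploaded coordinates. -/

namespace Mechanism

variable {n : ℕ} (M : Mechanism n)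

/-- The Hellinger affinity of the coordinates that are not uploaded, with all variances multiplied
by `c`. -/
noncomputable def tailAffinity (c : ℝ) (d : ℕ) : ℝ :=
  ∏ i : Fin n, if d ≤ (i : ℕ) then
    gaussAffinity (M.origMean i) (c * M.origVar i) (M.guessMean i) (c * M.guessVar i) else 1

variable {M} {c : ℝ}

lemma tailAffinity_factor_mem (hc : 0 < c) (d : ℕ) (i : Fin n) :
    (if d ≤ (i : ℕ) then gaussAffinity (M.origMean i) (c * M.origVar i) (M.guessMean i)
      (c * M.guessVar i) else 1) ∈ Set.Ioc (0 : ℝ) 1 := by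
  have h₁ := mul_pos hc (M.origVar_pos i)
  have h₂ := mul_pos hc (M.guessVar_pos i)
  split_ifs
  · exact ⟨gaussAffinity_pos _ _ h₁ h₂, gaussAffinity_le_one _ _ h₁ h₂⟩
  · simp

lemma tailAffinity_pos (hc : 0 < c) (d : ℕ) : 0 < M.tailAffinity c d :=
  Finset.prod_pos fun i _ => (tailAffinity_factor_mem hc d i).1

lemma tailAffinity_le_one (hc : 0 < c) (d : ℕ) : M.tailAffinity c d ≤ 1 :=
  Finset.prod_le_one (fun i _ => (tailAffinity_factor_mem hc d i).1.le)
    fun i _ => (tailAffinity_factor_mem hc d i).2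

lemma tailAffinity_factor_mono (hc : 0 < c) {d e : ℕ} (hde : d ≤ e) (i : Fin n) :
    (if d ≤ (i : ℕ) then gaussAffinity (M.origMean i) (c * M.origVar i) (M.guessMean i)
      (c * M.guessVar i) else 1) ≤ if e ≤ (i : ℕ) then gaussAffinity (M.origMean i)
      (c * M.origVar i) (M.guessMean i) (c * M.guessVar i) else 1 := by
  by_cases he : e ≤ (i : ℕ)
  · rw [if_pos he, if_pos (hde.trans he)]
  · rw [if_neg he]
    exact (tailAffinity_factor_mem hc d i).2

/-- Filling the uploaded coordinates with 1 puts all `d` on the index set `Fin n`, so the products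
compare factor by factor. -/
lemma tailAffinity_mono (hc : 0 < c) : Monotone (M.tailAffinity c) := fun d _ hde =>
  Finset.prod_le_prod (fun i _ => (tailAffinity_factor_mem hc d i).1.le)
    fun i _ => tailAffinity_factor_mono hc hde i

lemma tailAffinity_lt_succ (hc : 0 < c) {i : Fin n}
    (hi : M.origMean i ≠ M.guessMean i ∨ M.origVar i ≠ M.guessVar i) :
    M.tailAffinity c i < M.tailAffinity c (i + 1) := by
  refine Finset.prod_lt_prod (fun j _ => (tailAffinity_factor_mem hc _ j).1)
    (fun j _ => tailAffinity_factor_mono hc (Nat.le_succ _) j) ⟨i, Finset.mem_univ i, ?_⟩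
  rw [if_pos le_rfl, if_neg (by omega)]
  exact gaussAffinity_lt_one (mul_pos hc (M.origVar_pos i)) (mul_pos hc (M.guessVar_pos i))
    (hi.imp_right fun h h' => h (mul_left_cancel₀ hc.ne' h'))

lemma hTail_eq (hc : 0 < c) (d : ℕ) : M.hTail c d = √(1 - M.tailAffinity c d) := by
  unfold hTail
  rw [← Matrix.diagonal_smul, ← Matrix.diagonal_smul,
    hGauss_diagonal (v₁ := c • fun i : {i : Fin n // d ≤ (i : ℕ)} => M.origVar i.1)
      (v₂ := c • fun i : {i : Fin n // d ≤ (i : ℕ)} => M.guessVar i.1)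
      (fun i => mul_pos hc (M.origVar_pos i.1)) (fun i => mul_pos hc (M.guessVar_pos i.1))]
  unfold tailAffinity
  rw [← Finset.prod_filter]
  congr 2
  exact (Finset.prod_subtype _ (by simp) fun i : Fin n => gaussAffinity (M.origMean i)
    (c * M.origVar i) (M.guessMean i) (c * M.guessVar i)).symm

lemma hTail_antitone (hc : 0 < c) : Antitone (M.hTail c) := fun d e hde => by
  rw [hTail_eq hc, hTail_eq hc]
  have := tailAffinity_mono (M := M) hc hde
  gcongr

lemma hTail_nonneg (c : ℝ) (d : ℕ) : 0 ≤ M.hTail c d := Real.sqrt_nonneg _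

lemma hTail_succ_lt (hc : 0 < c) {i : Fin n}
    (hi : M.origMean i ≠ M.guessMean i ∨ M.origVar i ≠ M.guessVar i) :
    M.hTail c (i + 1) < M.hTail c i := by
  rw [hTail_eq hc, hTail_eq hc]
  have h1 := tailAffinity_lt_succ hc hi
  have h2 := tailAffinity_le_one (M := M) hc (i + 1)
  exact Real.sqrt_lt_sqrt (by linarith) (by linarith)

/-- With `a` the affinity of the tail and `a_K` that of the rescaled tail, `1 - a_K ≤ 1 - a^K ≤ K (1
- a)`; the second step is Bernoulli's inequality. -/
lemma hAgg_le {K : ℕ} (hK : 0 < K) (d : ℕ) : M.hAgg K d ≤ √K * M.h d := by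
  have hK' : (0 : ℝ) < 1 / K := by positivity
  unfold hAgg h
  rw [hTail_eq hK', hTail_eq one_pos, ← Real.sqrt_mul (by positivity)]
  apply Real.sqrt_le_sqrt
  have hpow : M.tailAffinity 1 d ^ K ≤ M.tailAffinity (1 / K) d := by
    unfold tailAffinity
    rw [← Finset.prod_pow]
    refine Finset.prod_le_prod (fun i _ => pow_nonneg (tailAffinity_factor_mem one_pos d i).1.le _)
      fun i _ => ?_
    split_ifs
    · rw [one_mul, one_mul]
      exact pow_gaussAffinity_le _ _ (M.origVar_pos i) (M.guessVar_pos i) hK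
    · simp
  have hb := one_add_mul_le_pow (a := M.tailAffinity 1 d - 1)
    (by linarith [tailAffinity_pos (M := M) one_pos d]) K
  rw [add_sub_cancel] at hb
  linarith

lemma protVar_pos (d : ℕ) (i : Fin n) : 0 < M.protVar d i := by
  unfold protVar
  split_ifs
  exacts [M.origVar_pos i, M.guessVar_pos i]

/-- Uploaded coordinates have affinity 1, so only the tail survives. The scale `c` is 1 for a single
client's law and `1/K` for the aggregate. -/
lemma abs_integral_sub_protected_le (hc : 0 < c) (d : ℕ) {g : Param n → ℝ} (hg : Measurable g)
    {a B : ℝ} (hg1 : ∀ x, a ≤ g x) (hg2 : ∀ x, g x ≤ a + B) :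
    |∫ x, g x ∂multivariateGaussian M.origMean (Matrix.diagonal fun i => c * M.origVar i)
        - ∫ x, g x ∂multivariateGaussian (M.protMean d)
          (Matrix.diagonal fun i => c * M.protVar d i)|
      ≤ B * (√2 * M.hTail c d) := by
  have h := abs_integral_gaussian_sub_le (m₁ := M.origMean) (m₂ := M.protMean d)
    (fun i => mul_pos hc (M.origVar_pos i)) (fun i => mul_pos hc (M.protVar_pos d i)) hg hg1 hg2
  convert h using 4
  rw [hTail_eq hc]
  congr 2
  refine Finset.prod_congr rfl fun i _ => ?_
  by_cases hi : (i : ℕ) < d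
  · rw [if_neg (by omega)]
    simp only [protMean, protVar, if_pos hi]
    exact (gaussAffinity_self _ (mul_pos hc (M.origVar_pos i))).symm
  · rw [if_pos (by omega)]
    simp only [protMean, protVar, if_neg hi]

end Mechanism

/-! ### Aggregated laws. -/

instance {n : ℕ} (K : ℕ) (P : Measure (Param n)) [IsProbabilityMeasure P] :
    IsProbabilityMeasure (aggregateLaw K P) :=
  Measure.isProbabilityMeasure_map (by fun_prop)

/-- The characteristic function of the average is the `K`-th power of the original one at `t/K`: the
linear term of the exponent is unchanged and the quadratic one is divided by `K`. -/
lemma aggregateLaw_gaussian {n K : ℕ} (hK : 0 < K) (m : Param n) {v : Fin n → ℝ}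
    (hv : ∀ i, 0 ≤ v i) :
    aggregateLaw K (multivariateGaussian m (Matrix.diagonal v))
      = multivariateGaussian m (Matrix.diagonal fun i => 1 / (K : ℝ) * v i) := by
  have hK' : (K : ℂ) ≠ 0 := by exact_mod_cast hK.ne'
  apply Measure.ext_of_charFun
  ext t
  unfold aggregateLaw
  rw [charFun_map_smul_comp (by fun_prop), charFun_map_sum_pi_eq_prod]
  simp only [Finset.prod_const, Pi.pow_apply, Finset.card_univ, Fintype.card_fin]
  rw [charFun_multivariateGaussian (Matrix.PosSemidef.diagonal hv),
    charFun_multivariateGaussian (Matrix.PosSemidef.diagonal fun i =>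
      mul_nonneg (by positivity) (hv i)), ← Complex.exp_nat_mul]
  congr 1
  simp only [Matrix.mulVec_diagonal, dotProduct, real_inner_smul_left, PiLp.smul_apply,
    smul_eq_mul, Complex.ofReal_sum, Complex.ofReal_mul, Complex.ofReal_div, Complex.ofReal_one,
    Complex.ofReal_natCast]
  rw [mul_sub, Finset.sum_div, Finset.sum_div, Finset.mul_sum]
  congr 1
  · field_simp
  · refine Finset.sum_congr rfl fun i _ => ?_
    field_simp

lemma measurable_of_sigma {A : Type*} {β : A → Type*} [∀ a, MeasurableSpace (β a)] {γ : Type*}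
    [MeasurableSpace γ] {f : (Σ a, β a) → γ} (h : ∀ a, Measurable fun x => f ⟨a, x⟩) :
    Measurable f := fun s hs => by
  rw [Sigma.instMeasurableSpace, MeasurableSpace.measurableSet_iInf]
  exact fun a => h a hs

/-! ### Beliefs, leakage and utility of one client. -/

namespace Client

variable {Z : Type*} [MeasurableSpace Z] {n : ℕ} {c : Client Z n}

lemma measurable_belief (P : Measure (Param n)) [SFinite P] : Measurable (c.belief P) :=
  (c.measurable_posterior.stronglyMeasurable.integral_prod_right (ν := P)).measurable

lemma integrableOn_prior : IntegrableOn c.prior c.support c.ref := by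
  by_contra h
  -- A non-integrable function has integral 0 by convention, so total mass 1 already forces
  -- integrability.
  exact one_ne_zero (c.integral_prior.symm.trans (integral_undef h))

lemma measurable_posterior_right (D : Dataset Z) : Measurable (c.posterior D) :=
  c.measurable_posterior.comp measurable_prodMk_left

variable {x : ℝ}

lemma posterior_bounds (hx : ∀ r ∈ c.logRatios, r ≤ x) {D : Dataset Z} (hD : D ∈ c.support)
    (w : Param n) : Real.exp (-x) * c.prior D ≤ c.posterior D w ∧
      c.posterior D w ≤ Real.exp x * c.prior D := by
  have hp := c.prior_pos D hD
  have hq := c.posterior_pos D hD w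
  obtain ⟨h1, h2⟩ := abs_le.1 (hx _ ⟨D, hD, w, rfl⟩)
  rw [Real.le_log_iff_exp_le (by positivity), le_div_iff₀ hp] at h1
  rw [Real.log_le_iff_le_exp (by positivity), div_le_iff₀ hp] at h2
  exact ⟨h1, h2⟩

lemma belief_bounds (hx : ∀ r ∈ c.logRatios, r ≤ x) (P : Measure (Param n))
    [IsProbabilityMeasure P] {D : Dataset Z} (hD : D ∈ c.support) :
    Real.exp (-x) * c.prior D ≤ c.belief P D ∧ c.belief P D ≤ Real.exp x * c.prior D := by
  have hb := posterior_bounds hx hD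
  have hint : Integrable (c.posterior D) P := by
    refine (integrable_const (Real.exp x * c.prior D)).mono'
      (measurable_posterior_right D).aestronglyMeasurable (ae_of_all _ fun w => ?_)
    rw [Real.norm_eq_abs, abs_of_pos (c.posterior_pos D hD w)]
    exact (hb w).2
  constructor
  · simpa [belief] using integral_mono (integrable_const (μ := P) _) hint fun w => (hb w).1
  · simpa [belief] using integral_mono hint (integrable_const (μ := P) _) fun w => (hb w).2

lemma belief_pos (hx : ∀ r ∈ c.logRatios, r ≤ x) (P : Measure (Param n))
    [IsProbabilityMeasure P] {D : Dataset Z} (hD : D ∈ c.support) : 0 < c.belief P D :=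
  (mul_pos (Real.exp_pos _) (c.prior_pos D hD)).trans_le (belief_bounds hx P hD).1

lemma integrableOn_belief (hx : ∀ r ∈ c.logRatios, r ≤ x) (P : Measure (Param n))
    [IsProbabilityMeasure P] : IntegrableOn (c.belief P) c.support c.ref := by
  refine Integrable.mono' (integrableOn_prior.const_mul (Real.exp x))
    (measurable_belief P).aestronglyMeasurable ?_
  filter_upwards [ae_restrict_mem c.measurableSet_support] with D hD
  rw [Real.norm_eq_abs, abs_of_pos (belief_pos hx P hD)]
  exact (belief_bounds hx P hD).2

/-- Beliefs formed from two laws of the model information have a small Jensen-Shannon divergence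
when they differ little relative to the prior. -/
lemma sqrt_jsDiv_belief_le (hx0 : 0 ≤ x) (hx : ∀ r ∈ c.logRatios, r ≤ x)
    (P Q : Measure (Param n)) [IsProbabilityMeasure P] [IsProbabilityMeasure Q] {T : ℝ}
    (hT : 0 ≤ T) (h : ∀ D ∈ c.support, |c.belief P D - c.belief Q D|
      ≤ (Real.exp x - Real.exp (-x)) * c.prior D * T) :
    √(jsDiv c.ref c.support (c.belief P) (c.belief Q)) ≤ (Real.exp (2 * x) - 1) / 2 * T := by
  have hexp : Real.exp (-x) * (Real.exp (2 * x) - 1) = Real.exp x - Real.exp (-x) := by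
    rw [mul_sub, ← Real.exp_add]
    ring_nf
  have hge : 0 ≤ Real.exp (2 * x) - 1 := by
    linarith [Real.one_le_exp (show 0 ≤ 2 * x by linarith)]
  obtain ⟨hi, he⟩ := integrableOn_jsKernel c.measurableSet_support (measurable_belief P)
    (measurable_belief Q) (integrableOn_belief hx P) (integrableOn_belief hx Q)
    (fun D hD => belief_pos hx P hD) (fun D hD => belief_pos hx Q hD)
  have hle : ∫ D in c.support, jsKernel (c.belief P D) (c.belief Q D) ∂c.ref
      ≤ ∫ D in c.support, ((Real.exp (2 * x) - 1) * T) ^ 2 / 2 * c.prior D ∂c.ref := by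
    refine integral_mono_ae hi (integrableOn_prior.const_mul _) ?_
    filter_upwards [ae_restrict_mem c.measurableSet_support] with D hD
    have hp := belief_pos hx P hD
    have hq := belief_pos hx Q hD
    have hf := c.prior_pos D hD
    refine (jsKernel_le hp hq).trans ?_
    rw [div_le_iff₀ (by positivity), ← sq_abs]
    have h1 := (belief_bounds hx P hD).1
    have h2 := (belief_bounds hx Q hD).1
    have hs : 2 * (Real.exp (-x) * c.prior D) ≤ c.belief P D + c.belief Q D := by linarith
    have he1 : Real.exp (-x) ≤ 1 := Real.exp_le_one_iff.2 (by linarith)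
    -- From `e^x - e^{-x} = e^{-x}(e^{2x} - 1)` the square carries `e^{-2x}`. One factor `e^{-x}`
    -- goes into the lower bound `2 e^{-x} f ≤ p + q` for the denominator, with `f` the prior; the
    -- other is bounded by 1.
    calc |c.belief P D - c.belief Q D| ^ 2
        ≤ ((Real.exp x - Real.exp (-x)) * c.prior D * T) ^ 2 := by
          gcongr
          exact h D hD
      _ = ((Real.exp (2 * x) - 1) * T) ^ 2 / 2 * c.prior D
            * (Real.exp (-x) * (2 * (Real.exp (-x) * c.prior D))) := by
          rw [← hexp]
          ring
      _ ≤ ((Real.exp (2 * x) - 1) * T) ^ 2 / 2 * c.prior D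
            * (1 * (2 * (Real.exp (-x) * c.prior D))) := by
          gcongr
      _ ≤ _ := by
          rw [one_mul]
          gcongr
  rw [integral_const_mul, c.integral_prior] at hle
  rw [he, Real.sqrt_le_left (by positivity)]
  nlinarith

lemma leakage_le_add (hx0 : 0 ≤ x) (hx : ∀ r ∈ c.logRatios, r ≤ x)
    (P Q : Measure (Param n)) [IsProbabilityMeasure P] [IsProbabilityMeasure Q] {T : ℝ}
    (hT : 0 ≤ T) (h : ∀ D ∈ c.support, |c.belief P D - c.belief Q D|
      ≤ (Real.exp x - Real.exp (-x)) * c.prior D * T) :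
    c.leakage P ≤ (Real.exp (2 * x) - 1) / 2 * T + c.leakage Q :=
  (sqrt_jsDiv_triangle c.measurableSet_support (measurable_belief P) (measurable_belief Q)
    c.measurable_prior (integrableOn_belief hx P) (integrableOn_belief hx Q) integrableOn_prior
    (fun _ hD => belief_pos hx P hD) (fun _ hD => belief_pos hx Q hD) c.prior_pos).trans
    (add_le_add_left (sqrt_jsDiv_belief_le hx0 hx P Q hT h) _)

lemma ae_mem_support : ∀ᵐ D ∂c.dataLaw, D ∈ c.support := c.dataLaw_compl_support

lemma support_nonempty : c.support.Nonempty := by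
  have := c.isProbabilityMeasure_dataLaw
  exact (ae_mem_support (c := c)).exists

/-- For each fixed data set the average utility is a function of `w` with values in `[0, B]`, so `h`
applies with a bound uniform in `D`, which then integrates against the data law. -/
lemma expectedUtility_sub_le {U : Param n → Z → ℝ} (hU : Measurable (Function.uncurry U))
    {B R : ℝ} (hUB : ∀ D ∈ c.support, ∀ i w, 0 ≤ U w (D.2 i) ∧ U w (D.2 i) ≤ B)
    (P Q : Measure (Param n)) [IsProbabilityMeasure P] [IsProbabilityMeasure Q]
    (h : ∀ g : Param n → ℝ, Measurable g → (∀ w, 0 ≤ g w) → (∀ w, g w ≤ B) →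
      |∫ w, g w ∂P - ∫ w, g w ∂Q| ≤ R) :
    c.expectedUtility U P - c.expectedUtility U Q ≤ R := by
  have := c.isProbabilityMeasure_dataLaw
  set u : Dataset Z → Param n → ℝ := fun D w => (1 / ((D.1 : ℝ) + 1)) * ∑ i, U w (D.2 i) with hu
  have hum : ∀ m : ℕ, Measurable fun y : (Fin (m + 1) → Z) × Param n => u ⟨m, y.1⟩ y.2 := by
    intro m
    have hi : ∀ i, Measurable fun y : (Fin (m + 1) → Z) × Param n => U y.2 (y.1 i) := fun i =>
      hU.comp (measurable_snd.prodMk ((measurable_pi_apply i).comp measurable_fst))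
    exact (Finset.measurable_sum Finset.univ fun i _ => hi i).const_mul (1 / ((m : ℝ) + 1))
  have hu0 : ∀ D ∈ c.support, ∀ w, 0 ≤ u D w := fun D hD w =>
    mul_nonneg (by positivity) (Finset.sum_nonneg fun i _ => (hUB D hD i w).1)
  have huB : ∀ D ∈ c.support, ∀ w, u D w ≤ B := fun D hD w => by
    have := Finset.sum_le_sum fun i (_ : i ∈ Finset.univ) => (hUB D hD i w).2
    rw [Finset.sum_const, Finset.card_univ, Fintype.card_fin, nsmul_eq_mul] at this
    simp only [hu]
    rw [one_div, inv_mul_le_iff₀ (by positivity)]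
    exact_mod_cast this
  have hint : ∀ (ρ : Measure (Param n)) [IsProbabilityMeasure ρ],
      Integrable (fun D => ∫ w, u D w ∂ρ) c.dataLaw := by
    intro ρ _
    -- Data sets vary in size, so measurability is checked for each size separately.
    have hmeas : Measurable fun D => ∫ w, u D w ∂ρ := measurable_of_sigma fun m =>
      ((hum m).stronglyMeasurable.integral_prod_right (ν := ρ)).measurable
    refine (integrable_const B).mono' hmeas.aestronglyMeasurable ?_
    filter_upwards [ae_mem_support] with D hD
    refine (norm_integral_le_of_norm_le (integrable_const B) (ae_of_all _ fun w => ?_)).trans ?_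
    · rw [Real.norm_eq_abs, abs_of_nonneg (hu0 D hD w)]
      exact huB D hD w
    · simp
  change ∫ D, ∫ w, u D w ∂P ∂c.dataLaw - ∫ D, ∫ w, u D w ∂Q ∂c.dataLaw ≤ R
  rw [← integral_sub (hint P) (hint Q)]
  have hle : ∫ D, (∫ w, u D w ∂P - ∫ w, u D w ∂Q) ∂c.dataLaw ≤ ∫ _, R ∂c.dataLaw := by
    refine integral_mono_ae ((hint P).sub (hint Q)) (integrable_const R) ?_
    filter_upwards [ae_mem_support] with D hD
    refine (le_abs_self _).trans (h (u D) ?_ (hu0 D hD) (huB D hD))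
    exact (hum D.1).comp measurable_prodMk_left
  simpa using hle

end Client

instance {n : ℕ} (M : Mechanism n) : IsProbabilityMeasure M.origLaw := by
  unfold Mechanism.origLaw
  infer_instance

instance {n : ℕ} (M : Mechanism n) (d : ℕ) : IsProbabilityMeasure (M.protLaw d) := by
  unfold Mechanism.protLaw
  infer_instance

/-! ### Averaging over clients. -/

section System

variable {Z : Type*} [MeasurableSpace Z] {n K : ℕ} {clients : Fin K → Client Z n}

/-- Finiteness of `ξ` enters here: without boundedness the real supremum would be the default value
0. -/
lemma le_xi (hxi : ∀ k, BddAbove (clients k).logRatios) (k : Fin K) :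
    ∀ r ∈ (clients k).logRatios, r ≤ xi clients := fun _ hr =>
  (le_csSup (hxi k) hr).trans
    (le_ciSup (f := fun k => sSup (clients k).logRatios) (Set.finite_range _).bddAbove k)

lemma xi_nonneg (clients : Fin K → Client Z n) : 0 ≤ xi clients := by
  refine Real.iSup_nonneg fun k => Real.sSup_nonneg ?_
  rintro _ ⟨D, -, w, rfl⟩
  exact abs_nonneg _

lemma constC₃_nonneg (clients : Fin K → Client Z n) : 0 ≤ constC₃ clients := by
  have := Real.one_le_exp (show 0 ≤ 2 * xi clients by linarith [xi_nonneg clients])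
  unfold constC₃
  have : 0 ≤ Real.exp (2 * xi clients) - 1 := by linarith
  positivity

/-- The Hellinger estimate is applied to `w ↦ f(D|w)`, whose oscillation is at most `e^ξ - e^{-ξ}`
times the prior. Taking `T = √2 h` turns `(e^{2ξ} - 1)/2 · T` into `C₃ h`. -/
lemma leakage_orig_le (hxi : ∀ k, BddAbove (clients k).logRatios) (M : Mechanism n) (d : ℕ)
    (k : Fin K) : (clients k).leakage M.origLaw
      ≤ constC₃ clients * M.h d + (clients k).leakage (M.protLaw d) := by
  have hx := le_xi hxi k
  have hT : 0 ≤ √2 * M.h d := mul_nonneg (Real.sqrt_nonneg _) (M.hTail_nonneg 1 d)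
  refine (Client.leakage_le_add (xi_nonneg clients) hx M.origLaw (M.protLaw d) hT
    fun D hD => ?_).trans (le_of_eq ?_)
  · have hb := Client.posterior_bounds hx hD
    have := M.abs_integral_sub_protected_le one_pos d
      ((clients k).measurable_posterior_right D) (fun w => (hb w).1)
      (B := (Real.exp (xi clients) - Real.exp (-xi clients)) * (clients k).prior D)
      (fun w => (hb w).2.trans (le_of_eq (by ring)))
    simp only [one_mul] at this
    exact this
  · unfold constC₃
    ring

lemma constC₁_sub_le (hK : 0 < K) (hxi : ∀ k, BddAbove (clients k).logRatios)
    (M : Mechanism n) (d : ℕ) :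
    constC₁ clients M - constC₃ clients * M.h d ≤ privacyLeakage clients M d := by
  have hK' : (0 : ℝ) < K := by exact_mod_cast hK
  have hsum := Finset.sum_le_sum fun k (_ : k ∈ Finset.univ) => leakage_orig_le hxi M d k
  rw [Finset.sum_add_distrib, Finset.sum_const, Finset.card_univ, Fintype.card_fin,
    nsmul_eq_mul] at hsum
  unfold constC₁ privacyLeakage avgLeakage
  rw [sub_le_iff_le_add, one_div, inv_mul_le_iff₀ hK', mul_add, mul_inv_cancel_left₀ hK'.ne']
  linarith

lemma utilityLoss_le (hK : 0 < K) (M : Mechanism n) {U : Param n → Z → ℝ}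
    (hU : Measurable (Function.uncurry U)) {C : ℝ}
    (hUC : ∀ k, ∀ D ∈ (clients k).support, ∀ i w,
      0 ≤ U w (D.2 i) ∧ √2 * U w (D.2 i) ≤ C) (d : ℕ) :
    utilityLoss clients M U d ≤ C * M.hAgg K d := by
  have hK' : (0 : ℝ) < K := by exact_mod_cast hK
  have h2 : (0 : ℝ) < √2 := by positivity
  have hk : ∀ k, (clients k).expectedUtility U (aggregateLaw K M.origLaw)
      - (clients k).expectedUtility U (aggregateLaw K (M.protLaw d)) ≤ C * M.hAgg K d := by
    intro k
    -- The normalisation `√2 U ≤ C` is chosen so that this `B` cancels the `√2` of the Hellinger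
    -- estimate.
    refine Client.expectedUtility_sub_le hU (B := C / √2) (fun D hD i w =>
      ⟨(hUC k D hD i w).1, by rw [le_div_iff₀' h2]; exact (hUC k D hD i w).2⟩) _ _
      fun g hg hg0 hgB => ?_
    unfold Mechanism.origLaw Mechanism.protLaw
    rw [aggregateLaw_gaussian hK _ fun i => (M.origVar_pos i).le,
      aggregateLaw_gaussian hK _ fun i => (M.protVar_pos d i).le]
    refine (M.abs_integral_sub_protected_le (one_div_pos.2 hK') d hg hg0
      (fun w => (hgB w).trans (zero_add _).ge)).trans (le_of_eq ?_)
    unfold Mechanism.hAgg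
    field_simp
  have hsum := Finset.sum_le_sum fun k (_ : k ∈ Finset.univ) => hk k
  rw [Finset.sum_const, Finset.card_univ, Fintype.card_fin, nsmul_eq_mul] at hsum
  unfold utilityLoss
  rwa [one_div, inv_mul_le_iff₀ hK']

end System

end FederatedSparsity

open FederatedSparsity in
theorem mainTheorem7 {Z : Type*} [MeasurableSpace Z] (n K : ℕ) (hK : 0 < K)
    (clients : Fin K → Client Z n) (M : Mechanism n)
    (hxi : ∀ k, BddAbove (clients k).logRatios)
    (U : Param n → Z → ℝ) (hU : Measurable (Function.uncurry U)) (C : ℝ)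
    (hUC : ∀ k, ∀ D ∈ (clients k).support, ∀ i w,
      0 ≤ U w (D.2 i) ∧ Real.sqrt 2 * U w (D.2 i) ≤ C) :
    -- `h` is decreasing in the number of uploaded dimensions, strictly at each step where the
    -- newly uploaded coordinate had a different law
    AntitoneOn M.h (Set.Iic n) ∧
    (∀ i : Fin n, (M.origMean i ≠ M.guessMean i ∨ M.origVar i ≠ M.guessVar i) →
      M.h ((i : ℕ) + 1) < M.h (i : ℕ)) ∧
    -- the privacy leakage is at least `C₁ - C₃ h`, which is increasing
    (∀ d ≤ n, constC₁ clients M - constC₃ clients * M.h d ≤ privacyLeakage clients M d) ∧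
    MonotoneOn (fun d => constC₁ clients M - constC₃ clients * M.h d) (Set.Iic n) ∧
    -- the utility loss is bounded through `h`, and the bounds are decreasing
    (∀ d ≤ n, utilityLoss clients M U d ≤ C * M.hAgg K d) ∧
    (∀ d ≤ n, utilityLoss clients M U d ≤ Real.sqrt K * C * M.h d) ∧
    AntitoneOn (fun d => C * M.h d) (Set.Iic n) ∧
    AntitoneOn (fun d => C * M.hAgg K d) (Set.Iic n) ∧
    AntitoneOn (fun d => Real.sqrt K * C * M.h d) (Set.Iic n) := by
  have hK' : (0 : ℝ) < 1 / K := by positivity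
  -- The sign of `C` comes from evaluating the utility bounds at one data point; one exists because
  -- the data law is a probability concentrated on the support and data sets are nonempty.
  have hC : 0 ≤ C := by
    obtain ⟨D, hD⟩ := (clients ⟨0, hK⟩).support_nonempty
    obtain ⟨h1, h2⟩ := hUC ⟨0, hK⟩ D hD 0 0
    exact (mul_nonneg (Real.sqrt_nonneg 2) h1).trans h2
  have hC₃ := constC₃_nonneg clients
  have hanti : Antitone M.h := Mechanism.hTail_antitone one_pos
  have hantiK : Antitone (M.hAgg K) := Mechanism.hTail_antitone hK'
  refine ⟨hanti.antitoneOn _, fun i hi => Mechanism.hTail_succ_lt one_pos hi,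
    fun d _ => constC₁_sub_le hK hxi M d, fun d _ e _ hde => ?_,
    fun d _ => utilityLoss_le hK M hU hUC d, fun d _ => ?_, (hanti.const_mul hC).antitoneOn _,
    (hantiK.const_mul hC).antitoneOn _, (hanti.const_mul (by positivity)).antitoneOn _⟩
  · exact sub_le_sub_left (mul_le_mul_of_nonneg_left (hanti hde) hC₃) _
  · calc utilityLoss clients M U d ≤ C * M.hAgg K d := utilityLoss_le hK M hU hUC d
      _ ≤ C * (√K * M.h d) := mul_le_mul_of_nonneg_left (Mechanism.hAgg_le hK d) hC
      _ = √K * C * M.h d := by ring
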